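/- All graphs are finite. For a graph $G$ and $A\subseteq V(G)$, an $A$-path is a path in $G$ with at least two vertices and both ends in $A$. For $X\subseteq V(G)$ and an integer $r\ge 0$, $B_G(X,r)$ is the set of vertices of $G$ at distance at most $r$ in $G$ from some vertex of $X$. Two paths are at distance at least $d$ if every vertex of the first is at distance at least $d$ in $G$ from every vertex of the second (vertices in different components being at distance $\infty$). Theorem. Let $f(k)=4k-4$ and $g(k,d)=256^k\,d$. For all positive integers $k$ and $d$, every graph $G$ and every $A\subseteq V(G)$, either $G$ contains $k$ $A$-paths that are pairwise at distance at least $d$, or there is a set $X\subseteq V(G)$ with $|X|\le f(k)$ such that every $A$-path in $G$ contains a vertex of $B_G(X,g(k,d))$. -/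

import Mathlib

namespace CoarseGallai

/-- An `A`-path in `G`: a path with at least two vertices and both ends in `A`
(internal vertices may or may not lie in `A`). -/
structure APath {V : Type*} (G : SimpleGraph V) (A : Set V) where
  /-- one end -/
  fst : V
  /-- the other end -/
  snd : V
  /-- the underlying walk -/
  walk : G.Walk fst snd
  isPath : walk.IsPath
  two_le : 2 ≤ walk.support.length
  fst_mem : fst ∈ A
  snd_mem : snd ∈ A

/-- The vertex set of an `A`-path. -/
def APath.verts {V : Type*} {G : SimpleGraph V} {A : Set V} (P : APath G A) : Set V :=
  {v | v ∈ P.walk.support}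

/-- The distance in `G` between two sets of vertices, with value `⊤` if no vertex of one
set is joined to a vertex of the other. -/
noncomputable def setDist {V : Type*} (G : SimpleGraph V) (X Y : Set V) : ℕ∞ :=
  ⨅ x ∈ X, ⨅ y ∈ Y, G.edist x y

/-- The (closed) ball of radius `r` around the set of vertices `X`. -/
def ball {V : Type*} (G : SimpleGraph V) (X : Set V) (r : ℕ) : Set V :=
  {y | setDist G X {y} ≤ (r : ℕ∞)}

end CoarseGallai

namespace CoarseGallai

/-! Induction on `k`, with `d` replaced by `256 * d`: either few balls already meet all `A`-paths,
or there are `k` very far apart `A`-paths, and the task is to gain one more path at scale `d` or to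
find `4 * k` balls (`exists_family_or_balls`).

Put balls around the ends of the `k` paths. If some `A`-path avoids them all and stays far from the
`k` paths, it is the extra path. Otherwise, follow it until it comes close to one of them, `E`, and
then go to `E` by a shortest route. This walk `W` and `E` have a tripod in their neighbourhood:
three legs from distinct vertices of `A` to a small ball around a hub, far apart outside that ball
(`exists_tripod`). The tripod replaces `E`, and its feet and hub replace the ends of `E` as ball
centres, four at most. When a later `A`-path avoids all balls and approaches a tripod, it arrives at
a leg away from the hub. It continues along this leg to its foot, the other two legs are joined
through the hub, and one path has become two (`exists_splits_of_hasTripod`). Each of the `k` paths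
turns into a tripod at most once, so the process stops.

The tripod comes from a race along `E` (`exists_tripod_of_race`): of two separated walks leading to
`E`, the one that makes contact earlier is extended along `E` towards the contact of the other,
until the two get close. The place where this happens is the hub, and the rest of `E` is the third
leg. -/

variable {V : Type*} {G : SimpleGraph V}

/-! ### Walks and bounded distance. -/

/-- `x` and `y` are joined by a walk of length at most `n`. -/
def Near (G : SimpleGraph V) (n : ℕ) (x y : V) : Prop :=
  ∃ p : G.Walk x y, p.length ≤ n

theorem Near.refl (n : ℕ) (x : V) : Near G n x x := ⟨.nil, by simp⟩

theorem Near.symm {n : ℕ} {x y : V} (h : Near G n x y) : Near G n y x := by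
  obtain ⟨p, hp⟩ := h
  exact ⟨p.reverse, by simpa using hp⟩

theorem Near.trans {m n : ℕ} {x y z : V} (h : Near G m x y) (h' : Near G n y z) :
    Near G (m + n) x z := by
  obtain ⟨p, hp⟩ := h
  obtain ⟨q, hq⟩ := h'
  exact ⟨p.append q, by rw [SimpleGraph.Walk.length_append]; omega⟩

theorem Near.mono {m n : ℕ} {x y : V} (h : Near G m x y) (hmn : m ≤ n) : Near G n x y := by
  obtain ⟨p, hp⟩ := h
  exact ⟨p, hp.trans hmn⟩

theorem Near.of_adj {x y : V} (h : G.Adj x y) : Near G 1 x y := ⟨h.toWalk, by simp⟩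

theorem edist_le_of_near {n : ℕ} {x y : V} (h : Near G n x y) : G.edist x y ≤ n := by
  obtain ⟨p, hp⟩ := h
  exact p.edist_le.trans (by exact_mod_cast hp)

theorem near_of_edist_le {n : ℕ} {x y : V} (h : G.edist x y ≤ n) : Near G n x y := by
  obtain ⟨p, hp⟩ := SimpleGraph.exists_walk_of_edist_ne_top
    (ne_top_of_le_ne_top (ENat.natCast_ne_top n) h)
  exact ⟨p, by rw [← hp] at h; exact_mod_cast h⟩

/-- A vertex of a walk splits its length. -/
theorem near_near_of_mem_support {n : ℕ} {x y z : V} (p : G.Walk x y) (hp : p.length ≤ n)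
    (hz : z ∈ p.support) : ∃ i j, i + j ≤ n ∧ Near G i x z ∧ Near G j z y := by
  obtain ⟨q, r, rfl⟩ := SimpleGraph.Walk.mem_support_iff_exists_append.1 hz
  exact ⟨q.length, r.length, by simpa using hp, ⟨q, le_rfl⟩, ⟨r, le_rfl⟩⟩

/-- The part of a walk up to its first vertex with property `S`, made into a path. -/
theorem exists_path_to_first (S : V → Prop) {u v : V} (p : G.Walk u v) (hv : S v) :
    ∃ (w : V) (q : G.Walk u w), q.IsPath ∧ q.support ⊆ p.support ∧ S w ∧
      ∀ y ∈ q.support, y = w ∨ ¬ S y := by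
  classical
  suffices ∃ (w : V) (q : G.Walk u w), q.support ⊆ p.support ∧ S w ∧
      ∀ y ∈ q.support, y = w ∨ ¬ S y by
    obtain ⟨w, q, h1, h2, h3⟩ := this
    exact ⟨w, q.bypass, q.bypass_isPath, fun y hy => h1 (q.support_bypass_subset_support hy), h2,
      fun y hy => h3 y (q.support_bypass_subset_support hy)⟩
  induction p with
  | nil => exact ⟨_, .nil, by simp, hv, by simp⟩
  | @cons u u' v hadj p ih =>
    by_cases hu : S u
    · exact ⟨u, .nil, by simp, hu, by simp⟩
    · obtain ⟨w, q, h1, h2, h3⟩ := ih hv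
      refine ⟨w, .cons hadj q, ?_, h2, ?_⟩
      · intro y hy
        simp only [SimpleGraph.Walk.support_cons, List.mem_cons] at hy ⊢
        exact hy.imp_right fun h => h1 h
      · intro y hy
        simp only [SimpleGraph.Walk.support_cons, List.mem_cons] at hy
        rcases hy with rfl | hy
        · exact Or.inr hu
        · exact h3 y hy

/-- The part of a walk up to its first vertex at distance at most `β + 1` from `h`. -/
theorem exists_walk_to_ball {β : ℕ} {h u v : V} (p : G.Walk u v) (hv : Near G (β + 1) v h)
    (hu : ¬ Near G β u h) :
    ∃ (w : V) (q : G.Walk u w), q.support ⊆ p.support ∧ Near G (β + 1) w h ∧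
      ∀ y ∈ q.support, ¬ Near G β y h := by
  induction p with
  | nil => exact ⟨_, .nil, by simp, hv, by simpa using hu⟩
  | @cons u u' v hadj p ih =>
    by_cases hu' : Near G (β + 1) u h
    · exact ⟨u, .nil, by simp, hu', by simpa using hu⟩
    · obtain ⟨w, q, h1, h2, h3⟩ := ih hv fun hc =>
        hu' (((Near.of_adj hadj).trans hc).mono (by omega))
      refine ⟨w, .cons hadj q, ?_, h2, ?_⟩
      · intro y hy
        simp only [SimpleGraph.Walk.support_cons, List.mem_cons] at hy ⊢
        exact hy.imp_right fun h => h1 h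
      · intro y hy
        simp only [SimpleGraph.Walk.support_cons, List.mem_cons] at hy
        rcases hy with rfl | hy
        · exact hu
        · exact h3 y hy

theorem exists_walk_of_adj_succ {N : ℕ} {b : ℕ → V} (hb : ∀ l < N, G.Adj (b l) (b (l + 1)))
    {i j : ℕ} (hij : i ≤ j) (hj : j ≤ N) :
    ∃ p : G.Walk (b i) (b j), ∀ y ∈ p.support, ∃ l, i ≤ l ∧ l ≤ j ∧ y = b l := by
  induction j, hij using Nat.le_induction with
  | base => exact ⟨.nil, fun y hy => ⟨i, le_rfl, le_rfl, by simpa using hy⟩⟩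
  | succ j hij ih =>
    obtain ⟨p, hp⟩ := ih (by omega)
    refine ⟨p.concat (hb j (by omega)), fun y hy => ?_⟩
    rw [SimpleGraph.Walk.support_concat, List.mem_append, List.mem_singleton] at hy
    rcases hy with hy | rfl
    · obtain ⟨l, h1, h2, h3⟩ := hp y hy
      exact ⟨l, h1, by omega, h3⟩
    · exact ⟨j + 1, by omega, le_rfl, rfl⟩

/-! ### Tripods near a path. -/

/-- Outside the ball of radius `β` around `h`, the sets `P` and `Q` are more than `ε` apart. -/
def SepOff (G : SimpleGraph V) (h : V) (β ε : ℕ) (P Q : Set V) : Prop :=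
  ∀ p ∈ P, ∀ q ∈ Q, ¬ Near G β p h ∨ ¬ Near G β q h → ¬ Near G ε p q

theorem SepOff.symm {h : V} {β ε : ℕ} {P Q : Set V} (hs : SepOff G h β ε P Q) :
    SepOff G h β ε Q P :=
  fun p hp q hq hpq hn => hs q hq p hp hpq.symm hn.symm

theorem SepOff.mono {h : V} {β ε : ℕ} {P Q P' Q' : Set V} (hs : SepOff G h β ε P Q)
    (hP : P' ⊆ P) (hQ : Q' ⊆ Q) : SepOff G h β ε P' Q' :=
  fun p hp q hq => hs p (hP hp) q (hQ hq)

/-- The set of vertices of a walk. -/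
def walkSet {u v : V} (p : G.Walk u v) : Set V := {y | y ∈ p.support}

/-- Three walks from `x`, `y`, `z` into the ball of radius `3 * ε` around `h`, separated outside
that ball, and near the set `K`. -/
def HasTripod (G : SimpleGraph V) (ε : ℕ) (K : Set V) (h x y z : V) : Prop :=
  ∃ (r s t : V) (P : G.Walk x r) (Q : G.Walk y s) (R : G.Walk z t),
    Near G (3 * ε) r h ∧ Near G (3 * ε) s h ∧ Near G (3 * ε) t h ∧
    SepOff G h (3 * ε) ε (walkSet P) (walkSet Q) ∧
    SepOff G h (3 * ε) ε (walkSet P) (walkSet R) ∧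
    SepOff G h (3 * ε) ε (walkSet Q) (walkSet R) ∧
    ∀ v ∈ walkSet P ∪ walkSet Q ∪ walkSet R, ∃ w ∈ K, Near G ε w v

theorem HasTripod.swap {ε : ℕ} {K : Set V} {h x y z : V} (H : HasTripod G ε K h x y z) :
    HasTripod G ε K h y x z := by
  obtain ⟨r, s, t, P, Q, R, h1, h2, h3, h4, h5, h6, h7⟩ := H
  refine ⟨s, r, t, Q, P, R, h2, h1, h3, h4.symm, h6, h5, fun v hv => h7 v ?_⟩
  rwa [Set.union_comm (walkSet P)]

/-- Two separated walks that both lead to the final part `b m, …, b N` of a path, and are away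
from it except at their ends, give a tripod. -/
theorem exists_tripod_of_race {ε N : ℕ} (hε : 1 ≤ ε) {b : ℕ → V}
    (hb : ∀ l < N, G.Adj (b l) (b (l + 1))) {K : Set V} (hbK : ∀ l ≤ N, b l ∈ K) (n : ℕ) :
    ∀ (m : ℕ), N < m + n → ∀ (x y r s : V) (P : G.Walk x r) (Q : G.Walk y s),
      P.IsPath → Q.IsPath →
      (∀ p ∈ P.support, ∀ q ∈ Q.support, ¬ Near G ε p q) →
      (∀ p ∈ P.support, p = r ∨ ∀ j, m ≤ j → j ≤ N → ¬ Near G ε p (b j)) →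
      (∀ q ∈ Q.support, q = s ∨ ∀ j, m ≤ j → j ≤ N → ¬ Near G ε q (b j)) →
      (∃ j, m ≤ j ∧ j ≤ N ∧ Near G ε r (b j)) →
      (∃ j, m ≤ j ∧ j ≤ N ∧ Near G ε s (b j)) →
      (∀ p ∈ P.support, ∃ w ∈ K, Near G ε w p) →
      (∀ q ∈ Q.support, ∃ w ∈ K, Near G ε w q) →
      ∃ l ≤ N, HasTripod G ε K (b l) x y (b N) := by
  classical
  induction n with
  | zero =>
    intro m hm x y r s P Q _ _ _ _ _ hr
    obtain ⟨j, h1, h2, -⟩ := hr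
    omega
  | succ n ih =>
    intro m hm
    -- The two walks play symmetric roles, so let `Q` be the one whose first contact has the larger
    -- index. Minimality of the contact index is needed only for `Q`.
    suffices H : ∀ (x y r s : V) (P : G.Walk x r) (Q : G.Walk y s),
      P.IsPath → Q.IsPath →
      (∀ p ∈ P.support, ∀ q ∈ Q.support, ¬ Near G ε p q) →
      (∀ p ∈ P.support, p = r ∨ ∀ j, m ≤ j → j ≤ N → ¬ Near G ε p (b j)) →
      (∀ q ∈ Q.support, q = s ∨ ∀ j, m ≤ j → j ≤ N → ¬ Near G ε q (b j)) →
      ∀ (z₁ z₂ : ℕ), z₁ ≤ z₂ → m ≤ z₁ → z₂ ≤ N → Near G ε r (b z₁) → Near G ε s (b z₂) →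
      (∀ j, m ≤ j → j < z₂ → ¬ Near G ε s (b j)) →
      (∀ p ∈ P.support, ∃ w ∈ K, Near G ε w p) →
      (∀ q ∈ Q.support, ∃ w ∈ K, Near G ε w q) →
      ∃ l ≤ N, HasTripod G ε K (b l) x y (b N) by
      intro x y r s P Q hP hQ hPQ hPb hQb hr hs hPK hQK
      obtain ⟨z₁, ⟨h11, h12, h13⟩, h14⟩ : ∃ z, (m ≤ z ∧ z ≤ N ∧ Near G ε r (b z)) ∧
          ∀ j, m ≤ j → j < z → ¬ Near G ε r (b j) := by
        refine ⟨Nat.find hr, Nat.find_spec hr, fun j h1 h2 h3 => Nat.find_min hr h2 ⟨h1, ?_, h3⟩⟩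
        exact h2.le.trans (Nat.find_spec hr).2.1
      obtain ⟨z₂, ⟨h21, h22, h23⟩, h24⟩ : ∃ z, (m ≤ z ∧ z ≤ N ∧ Near G ε s (b z)) ∧
          ∀ j, m ≤ j → j < z → ¬ Near G ε s (b j) := by
        refine ⟨Nat.find hs, Nat.find_spec hs, fun j h1 h2 h3 => Nat.find_min hs h2 ⟨h1, ?_, h3⟩⟩
        exact h2.le.trans (Nat.find_spec hs).2.1
      rcases le_total z₁ z₂ with h | h
      · exact H x y r s P Q hP hQ hPQ hPb hQb z₁ z₂ h h11 h22 h13 h23 h24 hPK hQK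
      · obtain ⟨l, hl, hT⟩ := H y x s r Q P hQ hP (fun p hp q hq hn => hPQ q hq p hp hn.symm)
          hQb hPb z₂ z₁ h h21 h12 h23 h13 h14 hQK hPK
        exact ⟨l, hl, hT.swap⟩
    intro x y r s P Q hP hQ hPQ hPb hQb z₁ z₂ hz hm1 hzN hr hs hmin hPK hQK
    -- the hub is `b z₁` as soon as a vertex of `Q` is close to it
    have hub : ∀ q₀ ∈ Q.support, Near G (2 * ε) q₀ (b z₁) →
        ∃ l ≤ N, HasTripod G ε K (b l) x y (b N) := by
      intro q₀ hq₀ hnear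
      obtain ⟨R, hR⟩ := exists_walk_of_adj_succ hb (hz.trans hzN) le_rfl
      -- Only the end `s` of `Q` may be close to the rest of `b`. As `Q` is a path, cutting it at
      -- another vertex `q₀` loses `s`.
      have hQs : ∀ q ∈ (Q.takeUntil q₀ hq₀).support, q = q₀ ∨
          ∀ j, m ≤ j → j ≤ N → ¬ Near G ε q (b j) := by
        intro q hq
        rcases hQb q (Q.support_takeUntil_subset_support hq₀ hq) with rfl | h
        · by_cases hqq : q = q₀
          · exact Or.inl hqq
          · exact absurd hq (SimpleGraph.Walk.endpoint_notMem_support_takeUntil hQ hq₀ hqq)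
        · exact Or.inr h
      -- This is where the radius `3 * ε` comes from: the end of a leg is within `2 * ε` of the hub,
      -- so a vertex of `R` within `ε` of that end is within `3 * ε` of the hub.
      have key : ∀ (p : V), (Near G (2 * ε) p (b z₁) ∨
          ∀ j, m ≤ j → j ≤ N → ¬ Near G ε p (b j)) → ∀ v ∈ R.reverse.support,
          ¬ Near G (3 * ε) p (b z₁) ∨ ¬ Near G (3 * ε) v (b z₁) → ¬ Near G ε p v := by
        intro p hp v hv hout hn
        rw [SimpleGraph.Walk.support_reverse, List.mem_reverse] at hv
        obtain ⟨l, hl1, hl2, rfl⟩ := hR v hv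
        rcases hp with hp | hp
        · rcases hout with h | h
          · exact h (hp.mono (by omega))
          · exact h ((hn.symm.trans hp).mono (by omega))
        · exact hp l (by omega) hl2 hn
      refine ⟨z₁, hz.trans hzN, r, q₀, b z₁, P, Q.takeUntil q₀ hq₀, R.reverse,
        hr.mono (by omega), hnear.mono (by omega), Near.refl _ _, ?_, ?_, ?_, ?_⟩
      · intro p hp q hq _
        exact hPQ p hp q (Q.support_takeUntil_subset_support hq₀ hq)
      · intro p hp v hv
        refine key p ?_ v hv
        rcases hPb p hp with rfl | h
        · exact Or.inl (hr.mono (by omega))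
        · exact Or.inr h
      · intro p hp v hv
        refine key p ?_ v hv
        rcases hQs p hp with rfl | h
        · exact Or.inl hnear
        · exact Or.inr h
      · rintro v ((hv | hv) | hv)
        · exact hPK v hv
        · exact hQK v (Q.support_takeUntil_subset_support hq₀ hv)
        · have hv : v ∈ R.reverse.support := hv
          rw [SimpleGraph.Walk.support_reverse, List.mem_reverse] at hv
          obtain ⟨l, hl1, hl2, rfl⟩ := hR v hv
          exact ⟨b l, hbK l hl2, Near.refl _ _⟩
    rcases hz.eq_or_lt with rfl | hlt
    · exact hub s Q.end_mem_support (hs.mono (by omega))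
    obtain ⟨S, hS⟩ := hr
    by_cases hconf : ∃ p ∈ S.support, ∃ q ∈ Q.support, Near G ε p q
    · obtain ⟨p, hp, q, hq, hpq⟩ := hconf
      obtain ⟨i, j, hij, -, hj⟩ := near_near_of_mem_support S hS hp
      exact hub q hq ((hpq.symm.trans hj).mono (by omega))
    -- Stopping one step before `z₂` keeps the extension away from `Q`, by minimality of `z₂`. Its
    -- last vertex is adjacent to `b z₂`, so a new contact exists. The race resumes with `m`
    -- replaced by `z₂ > m`.
    obtain ⟨B, hB⟩ := exists_walk_of_adj_succ hb (show z₁ ≤ z₂ - 1 by omega) (by omega)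
    obtain ⟨r', P', hP', hsub, ⟨j, hj1, hj2, hj3⟩, hfirst⟩ := exists_path_to_first
      (fun v => ∃ j, z₂ ≤ j ∧ j ≤ N ∧ Near G ε v (b j)) (P.append (S.append B)) (by
        refine ⟨z₂, le_rfl, hzN, (Near.of_adj ?_).mono hε⟩
        have := hb (z₂ - 1) (by omega)
        rwa [show z₂ - 1 + 1 = z₂ by omega] at this)
    have hmem : ∀ p ∈ P'.support, p ∈ P.support ∨ p ∈ S.support ∨ p ∈ B.support := by
      intro p hp
      have := hsub hp
      rwa [SimpleGraph.Walk.mem_support_append_iff, SimpleGraph.Walk.mem_support_append_iff] at this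
    refine ih z₂ (by omega) x y r' s P' Q hP' hQ ?_ ?_ ?_ ⟨j, hj1, hj2, hj3⟩
      ⟨z₂, le_rfl, hzN, hs⟩ ?_ hQK
    · intro p hp q hq hn
      rcases hmem p hp with h | h | h
      · exact hPQ p h q hq hn
      · exact hconf ⟨p, h, q, hq, hn⟩
      · obtain ⟨l, hl1, hl2, rfl⟩ := hB p h
        rcases hQb q hq with rfl | h
        · exact hmin l (by omega) (by omega) hn.symm
        · exact h l (by omega) (by omega) hn.symm
    · intro p hp
      refine (hfirst p hp).imp_right fun h j h1 h2 h3 => h ⟨j, h1, h2, h3⟩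
    · intro q hq
      exact (hQb q hq).imp_right fun h j h1 => h j (by omega)
    · intro p hp
      rcases hmem p hp with h | h | h
      · exact hPK p h
      · obtain ⟨i, j, hij, -, hj⟩ := near_near_of_mem_support S hS h
        exact ⟨b z₁, hbK _ (by omega), hj.symm.mono (by omega)⟩
      · obtain ⟨l, hl1, hl2, rfl⟩ := hB p h
        exact ⟨b l, hbK l (by omega), Near.refl _ _⟩

/-- A walk `E` and a walk `W` that leads to it contain a tripod in their neighbourhood. -/
theorem exists_tripod {ε : ℕ} (hε : 1 ≤ ε) {x y z w : V} (E : G.Walk x z) (W : G.Walk y w)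
    (hw : w ∈ E.support) (hW : ∀ p ∈ W.support, ¬ Near G ε x p) :
    ∃ h ∈ E.support, HasTripod G ε (walkSet E ∪ walkSet W) h x y z := by
  obtain ⟨j₀, hj₀, hj₀'⟩ := SimpleGraph.Walk.mem_support_iff_exists_getVert.1 hw
  obtain ⟨s, Q, hQ, hQW, ⟨j, hj1, hj2⟩, hfirst⟩ := exists_path_to_first
    (fun v => ∃ j ≤ E.length, Near G ε v (E.getVert j)) W ⟨j₀, hj₀', hj₀ ▸ Near.refl _ _⟩
  -- The race starts with the trivial walk at `x`, the first vertex of `E`, against the part of `W`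
  -- up to its first contact with `E`.
  obtain ⟨l, hl, hT⟩ := exists_tripod_of_race hε (b := E.getVert) (N := E.length)
    (K := walkSet E ∪ walkSet W) (fun l hl => E.adj_getVert_succ hl)
    (fun l _ => Or.inl (E.getVert_mem_support l)) (E.length + 1) 0 (by omega) x y x s .nil Q
    (by simp) hQ (by simpa using fun q hq => hW q (hQW hq)) (by simp)
    (fun q hq => (hfirst q hq).imp_right fun h j _ h2 h3 => h ⟨j, h2, h3⟩)
    ⟨0, le_rfl, Nat.zero_le _, by simpa using Near.refl _ _⟩ ⟨j, Nat.zero_le _, hj1, hj2⟩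
    (by simpa using ⟨x, Or.inl E.start_mem_support, Near.refl _ _⟩)
    (fun q hq => ⟨q, Or.inr (hQW hq), Near.refl _ _⟩)
  exact ⟨_, E.getVert_mem_support l, by simpa using hT⟩

/-! ### `A`-paths, far apart sets and splitting. -/

theorem mem_walkSet {u v y : V} {p : G.Walk u v} : y ∈ walkSet p ↔ y ∈ p.support := Iff.rfl

theorem exists_aPath {A : Set V} {a b : V} (ha : a ∈ A) (hb : b ∈ A) (hab : a ≠ b)
    (p : G.Walk a b) : ∃ P : APath G A, P.verts ⊆ walkSet p := by
  classical
  refine ⟨⟨a, b, p.bypass, p.bypass_isPath, ?_, ha, hb⟩,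
    fun y hy => p.support_bypass_subset_support hy⟩
  rw [SimpleGraph.Walk.length_support]
  have : p.bypass.length ≠ 0 := fun h => hab (SimpleGraph.Walk.eq_of_length_eq_zero h)
  omega

theorem APath.fst_ne_snd {A : Set V} (P : APath G A) : P.fst ≠ P.snd := by
  obtain ⟨a, b, p, hp, h2, -, -⟩ := P
  rintro (rfl : a = b)
  rw [SimpleGraph.Walk.isPath_iff_nil, ← SimpleGraph.Walk.length_eq_zero_iff] at hp
  rw [SimpleGraph.Walk.length_support] at h2
  omega

/-- `S` and `T` are more than `d` apart. -/
def FarSets (G : SimpleGraph V) (d : ℕ) (S T : Set V) : Prop :=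
  ∀ x ∈ S, ∀ y ∈ T, ¬ Near G d x y

theorem FarSets.symm {d : ℕ} {S T : Set V} (h : FarSets G d S T) : FarSets G d T S :=
  fun x hx y hy hn => h y hy x hx hn.symm

theorem FarSets.mono {d d' : ℕ} {S T S' T' : Set V} (h : FarSets G d S T) (hd : d' ≤ d)
    (hS : S' ⊆ S) (hT : T' ⊆ T) : FarSets G d' S' T' :=
  fun x hx y hy hn => h x (hS hx) y (hT hy) (hn.mono hd)

theorem FarSets.union_left {d : ℕ} {S S' T : Set V} (h : FarSets G d S T)
    (h' : FarSets G d S' T) : FarSets G d (S ∪ S') T :=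
  fun x hx => hx.elim (h x) (h' x)

/-- The walk `W` approaches `T` only in the direction of `x`, up to distance `s`. -/
def Approaches (G : SimpleGraph V) (s : ℕ) (x : V) (W T : Set V) : Prop :=
  ∀ p ∈ W, ∀ y ∈ T, ∀ n ≤ s, Near G n p y → Near G n p x

/-- A point of `W` within `n` of `T` is also within `n` of `x`, which puts `x` within `2 * n` of
`T`. Approaching thus costs a factor of two in distance. -/
theorem Approaches.farSets {s n c : ℕ} {x : V} {W T : Set V} (h : Approaches G s x W T)
    (hx : FarSets G c {x} T) (hn : n ≤ s) (hc : 2 * n ≤ c) : FarSets G n W T :=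
  fun p hp y hy hpy => hx x rfl y hy (((h p hp y hy n hn hpy).symm.trans hpy).mono (by omega))

/-- A walk from `A` that reaches `T` away from `X` yields, together with `T`, two `A`-paths more
than `d` apart, one of them inside `T`. -/
def Splits (G : SimpleGraph V) (A : Set V) (d s ρ : ℕ) (T : Set V) (X : Set V) : Prop :=
  ∀ a ∈ A, ∀ x ∈ T, ∀ W : G.Walk a x, Approaches G s x (walkSet W) T →
    (∀ z ∈ X, ¬ Near G ρ a z) → (∀ z ∈ X, ¬ Near G ρ x z) →
    ∃ P Q : APath G A, P.verts ⊆ walkSet W ∪ T ∧ Q.verts ⊆ T ∧ FarSets G d P.verts Q.verts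

/-- The distance of a point of a geodesic from the boundary of a ball to its centre from points
outside the ball. -/
theorem not_near_of_mem_radius {β ε n : ℕ} {h t y p : V} (M : G.Walk t h)
    (hM : M.length ≤ β + 1) (hp : p ∈ M.support) (hy : ¬ Near G β y h) (hyt : ¬ Near G ε y t)
    (hn : 2 * n ≤ ε) : ¬ Near G n y p := by
  intro hyp
  obtain ⟨i, j, hij, hi, hj⟩ := near_near_of_mem_support M hM hp
  -- With `i + j ≤ β + 1`, these two bounds add up to `2 * n > ε`.
  have h1 : ¬ n + j ≤ β := fun hc => hy ((hyp.trans hj).mono hc)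
  have h2 : ¬ n + i ≤ ε := fun hc => hyt ((hyp.trans hi.symm).mono hc)
  omega

/-- The walk `W` is continued along the leg `L` to its foot `u`, and the other two legs are joined
through the hub `h`. The separation `4 * d` is halved twice: to `2 * d` between `L` and the radii
`M₂`, `M₃`, and to `d` between `W` and the joined legs. -/
theorem exists_split_at_leg {A : Set V} {d s β : ℕ} (hs : d ≤ s) {h u v w r t₂ t₃ : V} (hu : u ∈ A)
    (hv : v ∈ A) (hw : w ∈ A) (hvw : v ≠ w) (L : G.Walk u r) (L₂ : G.Walk v t₂)
    (M₂ : G.Walk t₂ h) (L₃ : G.Walk w t₃) (M₃ : G.Walk t₃ h) (hM₂ : M₂.length ≤ β + 1)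
    (hM₃ : M₃.length ≤ β + 1) (hL : ∀ y ∈ L.support, ¬ Near G β y h)
    (h₂ : FarSets G (4 * d) (walkSet L) (walkSet L₂))
    (h₃ : FarSets G (4 * d) (walkSet L) (walkSet L₃)) {T : Set V} (hT₁ : walkSet L ⊆ T)
    (hT₂ : walkSet L₂ ⊆ T) (hT₃ : walkSet L₃ ⊆ T) (hT₂' : walkSet M₂ ⊆ T) (hT₃' : walkSet M₃ ⊆ T)
    {a x : V} (ha : a ∈ A) (hau : a ≠ u) (hx : x ∈ L.support) (W : G.Walk a x)
    (hW : Approaches G s x (walkSet W) T) :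
    ∃ P Q : APath G A, P.verts ⊆ walkSet W ∪ T ∧ Q.verts ⊆ T ∧ FarSets G d P.verts Q.verts := by
  classical
  obtain ⟨P, hP⟩ := exists_aPath ha hu hau (W.append (L.takeUntil x hx).reverse)
  obtain ⟨Q, hQ⟩ := exists_aPath hv hw hvw (L₂.append (M₂.append (M₃.reverse.append L₃.reverse)))
  have hP' : P.verts ⊆ walkSet W ∪ walkSet L := by
    intro y hy
    have := hP hy
    simp only [mem_walkSet, SimpleGraph.Walk.mem_support_append_iff,
      SimpleGraph.Walk.support_reverse, List.mem_reverse] at this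
    exact this.imp id fun h => L.support_takeUntil_subset_support hx h
  have hQ' : Q.verts ⊆ walkSet L₂ ∪ walkSet M₂ ∪ walkSet M₃ ∪ walkSet L₃ := by
    intro y hy
    have := hQ hy
    simp only [mem_walkSet, SimpleGraph.Walk.mem_support_append_iff,
      SimpleGraph.Walk.support_reverse, List.mem_reverse] at this
    simp only [Set.mem_union, mem_walkSet]
    tauto
  have hQT : Q.verts ⊆ T := hQ'.trans
    (Set.union_subset (Set.union_subset (Set.union_subset hT₂ hT₂') hT₃') hT₃)
  have hLQ : FarSets G (2 * d) (walkSet L) Q.verts := by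
    intro y hy q hq hn
    rcases hQ' hq with ((hq | hq) | hq) | hq
    · exact h₂ y hy q hq (hn.mono (by omega))
    · exact not_near_of_mem_radius M₂ hM₂ hq (hL y hy) (h₂ y hy _ L₂.end_mem_support)
        (by omega) hn
    · exact not_near_of_mem_radius M₃ hM₃ hq (hL y hy) (h₃ y hy _ L₃.end_mem_support)
        (by omega) hn
    · exact h₃ y hy q hq (hn.mono (by omega))
  refine ⟨P, Q, hP'.trans (Set.union_subset_union_right _ hT₁), hQT, ?_⟩
  have hWQ : FarSets G d (walkSet W) Q.verts :=
    Approaches.farSets (x := x) (s := s) (c := 2 * d)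
      (fun p hp y hy => hW p hp y (hQT hy))
      (hLQ.mono le_rfl (Set.singleton_subset_iff.2 hx) subset_rfl) hs le_rfl
  exact (hWQ.union_left (hLQ.mono (by omega) subset_rfl subset_rfl)).mono le_rfl hP' subset_rfl

/-- A walk into a ball, cut when it comes close to the ball, and a walk from there to the
centre. -/
theorem exists_leg {β : ℕ} {h u r : V} (p : G.Walk u r) (hr : Near G β r h) :
    ∃ (t : V) (L : G.Walk u t) (M : G.Walk t h), walkSet L ⊆ walkSet p ∧ M.length ≤ β + 1 ∧
      ((∀ y ∈ L.support, ¬ Near G β y h) ∨ ∀ y ∈ L.support, Near G (β + 1) y h) := by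
  by_cases hu : Near G β u h
  · obtain ⟨M, hM⟩ := hu
    refine ⟨u, .nil, M, fun y hy => ?_, by omega, Or.inr ?_⟩
    · obtain rfl : y = u := by simpa [mem_walkSet] using hy
      exact p.start_mem_support
    · simpa using ⟨M, by omega⟩
  · obtain ⟨t, L, h1, ⟨M, hM⟩, h3⟩ := exists_walk_to_ball p (hr.mono (Nat.le_succ β)) hu
    exact ⟨t, L, M, h1, hM, Or.inl h3⟩

/-- The set `T` consists of the three legs, cut on reaching the ball around the hub, and radii from
there to the hub. Each radius has length at most `12 * d + 1 ≤ 13 * d`. -/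
theorem exists_splits_of_hasTripod {A : Set V} {d s ρ : ℕ} (hd : 1 ≤ d) (hs : d ≤ s)
    (hρ : 13 * d ≤ ρ) {K : Set V} {h u v w : V} (hK : h ∈ K) (hu : u ∈ A) (hv : v ∈ A)
    (hw : w ∈ A) (huv : u ≠ v) (huw : u ≠ w) (hvw : v ≠ w)
    (H : HasTripod G (4 * d) K h u v w) :
    ∃ T : Set V, Splits G A d s ρ T {u, v, w, h} ∧ (∃ P : APath G A, P.verts ⊆ T) ∧
      ∀ y ∈ T, ∃ z ∈ K, Near G (13 * d) z y := by
  obtain ⟨r₁, r₂, r₃, P₁, P₂, P₃, hr₁, hr₂, hr₃, s₁₂, s₁₃, s₂₃, hKP⟩ := H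
  obtain ⟨β, hβ⟩ : ∃ β, β = 3 * (4 * d) := ⟨_, rfl⟩
  rw [← hβ] at hr₁ hr₂ hr₃ s₁₂ s₁₃ s₂₃
  obtain ⟨t₁, L₁, M₁, hLP₁, hM₁, hL₁⟩ := exists_leg P₁ hr₁
  obtain ⟨t₂, L₂, M₂, hLP₂, hM₂, hL₂⟩ := exists_leg P₂ hr₂
  obtain ⟨t₃, L₃, M₃, hLP₃, hM₃, hL₃⟩ := exists_leg P₃ hr₃
  replace s₁₂ := s₁₂.mono hLP₁ hLP₂
  replace s₁₃ := s₁₃.mono hLP₁ hLP₃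
  replace s₂₃ := s₂₃.mono hLP₂ hLP₃
  obtain ⟨T, hT⟩ : ∃ T, T = walkSet L₁ ∪ walkSet L₂ ∪ walkSet L₃ ∪
    (walkSet M₁ ∪ walkSet M₂ ∪ walkSet M₃) := ⟨_, rfl⟩
  have lT₁ : walkSet L₁ ⊆ T := fun y hy => hT ▸ Or.inl (Or.inl (Or.inl hy))
  have lT₂ : walkSet L₂ ⊆ T := fun y hy => hT ▸ Or.inl (Or.inl (Or.inr hy))
  have lT₃ : walkSet L₃ ⊆ T := fun y hy => hT ▸ Or.inl (Or.inr hy)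
  have mT₁ : walkSet M₁ ⊆ T := fun y hy => hT ▸ Or.inr (Or.inl (Or.inl hy))
  have mT₂ : walkSet M₂ ⊆ T := fun y hy => hT ▸ Or.inr (Or.inl (Or.inr hy))
  have mT₃ : walkSet M₃ ⊆ T := fun y hy => hT ▸ Or.inr (Or.inr hy)
  refine ⟨T, ?_, ?_, ?_⟩
  · intro a ha x hx W hW haX hxX
    have hne : ∀ z ∈ ({u, v, w, h} : Set V), a ≠ z := by
      rintro z hz rfl
      exact haX a hz (Near.refl _ _)
    -- Being away from the hub, `x` lies on no radius, and its leg is not one that lies inside the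
    -- ball. Hence that leg is far from the other two.
    have hxh : ¬ Near G (β + 1) x h := fun hn => hxX h (by simp) (hn.mono (by omega))
    have hout : ∀ {y t : V} {L : G.Walk y t}, x ∈ L.support →
        ((∀ y ∈ L.support, ¬ Near G (β) y h) ∨
          ∀ y ∈ L.support, Near G (β + 1) y h) →
        ∀ y ∈ L.support, ¬ Near G (β) y h :=
      fun hx hL => hL.resolve_right fun hc => hxh (hc x hx)
    have hM : ∀ {t : V} {M : G.Walk t h}, M.length ≤ β + 1 → x ∉ M.support := by
      intro t M hM hx
      obtain ⟨i, j, hij, -, hj⟩ := near_near_of_mem_support M hM hx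
      exact hxh (hj.mono (by omega))
    have far : ∀ {S S' : Set V}, SepOff G h (β) (4 * d) S S' →
        (∀ y ∈ S, ¬ Near G (β) y h) → FarSets G (4 * d) S S' :=
      fun hS ho y hy z hz => hS y hy z hz (Or.inl (ho y hy))
    rw [hT] at hx
    rcases hx with ((hx | hx) | hx) | ((hx | hx) | hx)
    · exact exists_split_at_leg hs hu hv hw hvw L₁ L₂ M₂ L₃ M₃ hM₂ hM₃ (hout hx hL₁)
        (far s₁₂ (hout hx hL₁)) (far s₁₃ (hout hx hL₁)) lT₁ lT₂ lT₃ mT₂ mT₃ ha (hne _ (by simp)) hx W hW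
    · exact exists_split_at_leg hs hv hu hw huw L₂ L₁ M₁ L₃ M₃ hM₁ hM₃ (hout hx hL₂)
        (far s₁₂.symm (hout hx hL₂)) (far s₂₃ (hout hx hL₂)) lT₂ lT₁ lT₃ mT₁ mT₃ ha (hne _ (by simp)) hx W hW
    · exact exists_split_at_leg hs hw hu hv huv L₃ L₁ M₁ L₂ M₂ hM₁ hM₂ (hout hx hL₃)
        (far s₁₃.symm (hout hx hL₃)) (far s₂₃.symm (hout hx hL₃)) lT₃ lT₁ lT₂ mT₁ mT₂ ha (hne _ (by simp)) hx W hW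
    · exact absurd hx (hM hM₁)
    · exact absurd hx (hM hM₂)
    · exact absurd hx (hM hM₃)
  · obtain ⟨P, hP⟩ := exists_aPath hu hv huv (L₁.append (M₁.append (M₂.reverse.append L₂.reverse)))
    refine ⟨P, fun y hy => ?_⟩
    have := hP hy
    simp only [mem_walkSet, SimpleGraph.Walk.mem_support_append_iff,
      SimpleGraph.Walk.support_reverse, List.mem_reverse] at this
    rcases this with hy | hy | hy | hy
    exacts [lT₁ hy, mT₁ hy, mT₂ hy, lT₂ hy]
  · have hM : ∀ {t y : V} {M : G.Walk t h}, M.length ≤ β + 1 → y ∈ M.support →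
        ∃ z ∈ K, Near G (13 * d) z y := by
      intro t y M hM hy
      obtain ⟨i, j, hij, -, hj⟩ := near_near_of_mem_support M hM hy
      exact ⟨h, hK, hj.symm.mono (by omega)⟩
    intro y hy
    rw [hT] at hy
    rcases hy with hy | ((hy | hy) | hy)
    · have : y ∈ walkSet P₁ ∪ walkSet P₂ ∪ walkSet P₃ := by
        exact Set.union_subset_union (Set.union_subset_union hLP₁ hLP₂) hLP₃ hy
      obtain ⟨z, hz, hzy⟩ := hKP y this
      exact ⟨z, hz, hzy.mono (by omega)⟩
    · exact hM hM₁ hy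
    · exact hM hM₂ hy
    · exact hM hM₃ hy

/-! ### From `k` far apart sets to `k + 1` paths or `4 * k` balls. -/

theorem exists_family_cons {A : Set V} {k d : ℕ} (P₀ : APath G A) (P : Fin k → APath G A)
    (h₀ : ∀ i, FarSets G d P₀.verts (P i).verts)
    (h : ∀ i j, i ≠ j → FarSets G d (P i).verts (P j).verts) :
    ∃ Q : Fin (k + 1) → APath G A, ∀ i j, i ≠ j → FarSets G d (Q i).verts (Q j).verts := by
  refine ⟨Fin.cons P₀ P, fun i j => ?_⟩
  refine Fin.cases ?_ (fun i => ?_) i <;> refine Fin.cases ?_ (fun j => ?_) j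
  · exact fun h => absurd rfl h
  · exact fun _ => by simpa using h₀ j
  · exact fun _ => by simpa using (h₀ i).symm
  · exact fun hij => by simpa using h i j fun hc => hij (hc ▸ rfl)

/-- A walk that comes within distance `s` of the union of the sets `T i` begins with an approach to
one of them. -/
theorem exists_approach {ι : Type*} {s : ℕ} (T : ι → Set V) {a b : V} (P : G.Walk a b)
    (hP : ∃ p ∈ P.support, ∃ i, ∃ y ∈ T i, Near G s p y) :
    ∃ (i : ι) (x : V) (W : G.Walk a x), x ∈ T i ∧ (∀ j, Approaches G s x (walkSet W) (T j)) ∧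
      ∀ p ∈ W.support, ∃ q ∈ P.support, Near G s q p := by
  classical
  obtain ⟨p, hp, hpT⟩ := hP
  obtain ⟨w, Q, -, hQP, hw, hQ⟩ := exists_path_to_first
    (fun v => ∃ i, ∃ y ∈ T i, Near G s v y) (P.takeUntil p hp) hpT
  replace hQP := fun y hy => P.support_takeUntil_subset_support hp (hQP (a := y) hy)
  -- Taking `x` nearest to `w` in the union of all `T i` makes the walk an approach with respect to
  -- every `T j`, not only the one that contains `x`.
  have hn : ∃ n, ∃ i, ∃ y ∈ T i, Near G n w y := ⟨s, hw⟩
  obtain ⟨i, x, hx, M, hM⟩ := Nat.find_spec hn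
  have hns : Nat.find hn ≤ s := Nat.find_min' hn hw
  have hmin : ∀ n, (∃ i, ∃ y ∈ T i, Near G n w y) → Nat.find hn ≤ n :=
    fun n h => Nat.find_min' hn h
  generalize Nat.find hn = n₀ at hM hns hmin
  have hMx : ∀ j, Approaches G s x (walkSet M) (T j) := by
    intro j q hq y hy n _ hqy
    obtain ⟨i₁, i₂, h12, h1, h2⟩ := near_near_of_mem_support M hM hq
    have := hmin _ ⟨j, y, hy, h1.trans hqy⟩
    exact h2.mono (by omega)
  refine ⟨i, x, Q.append M, hx, fun j q hq => ?_, fun q hq => ?_⟩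
  · rw [mem_walkSet, SimpleGraph.Walk.mem_support_append_iff] at hq
    rcases hq with hq | hq
    · rcases hQ q hq with rfl | h
      · exact hMx j q M.start_mem_support
      · exact fun y hy n hn hqy => absurd ⟨j, y, hy, hqy.mono hn⟩ h
    · exact hMx j q hq
  · rw [SimpleGraph.Walk.mem_support_append_iff] at hq
    rcases hq with hq | hq
    · exact ⟨q, hQP q hq, Near.refl _ _⟩
    · obtain ⟨i₁, i₂, h12, h1, h2⟩ := near_near_of_mem_support M hM hq
      exact ⟨w, hQP w Q.end_mem_support, h1.mono (by omega)⟩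

theorem FarSets.of_near {c r n : ℕ} {S S' T : Set V} (h : FarSets G c S T)
    (hS : ∀ y ∈ S', ∃ z ∈ S, Near G r z y) (hn : r + n ≤ c) : FarSets G n S' T := by
  intro y hy t ht hyt
  obtain ⟨z, hz, hzy⟩ := hS y hy
  exact h z hz t ht ((hzy.trans hyt).mono hn)

/-- Given `k` far apart sets, each an `A`-path or a set that splits (those with index in `U`), there
are `k + 1` far apart `A`-paths or `4 * k` balls that meet all `A`-paths. -/
theorem exists_family_or_balls {A : Set V} {k d : ℕ} (hd : 1 ≤ d) (n : ℕ) :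
    ∀ (U : Finset (Fin k)) (T : Fin k → Set V) (X : Fin k → Finset V), k < U.card + n →
      (∀ i, (X i).card ≤ 4) → (∀ i, ∃ P : APath G A, P.verts ⊆ T i) →
      (∀ i ∈ U, Splits G A d (100 * d) (100 * d) (T i) (X i)) →
      (∀ i ∉ U, ∃ P : APath G A, T i = P.verts ∧ P.fst ∈ X i ∧ P.snd ∈ X i) →
      (∀ i j, i ≠ j → FarSets G (25 * d) (T i) (T j)) →
      (∀ i j, i ≠ j → i ∉ U → FarSets G (80 * d) (T i) (T j)) →
      (∀ i j, i ≠ j → i ∉ U → j ∉ U → FarSets G (200 * d) (T i) (T j)) →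
      (∃ P : Fin (k + 1) → APath G A, ∀ i j, i ≠ j → FarSets G d (P i).verts (P j).verts) ∨
      ∃ Y : Finset V, Y.card ≤ 4 * k ∧
        ∀ P : APath G A, ∃ p ∈ P.verts, ∃ z ∈ Y, Near G (200 * d) p z := by
  classical
  induction n with
  | zero =>
    intro U T X hU
    have := U.card_le_univ
    rw [Fintype.card_fin] at this
    omega
  | succ n ih =>
    intro U T X hU hX hT hsplit hpath hfar hfar₁ hfar₂
    by_cases hY : ∀ P : APath G A, ∃ p ∈ P.verts, ∃ z ∈ Finset.univ.biUnion X,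
        Near G (200 * d) p z
    · refine Or.inr ⟨_, ?_, hY⟩
      refine Finset.card_biUnion_le.trans ((Finset.sum_le_card_nsmul _ _ 4 fun i _ => hX i).trans ?_)
      simp [mul_comm]
    push Not at hY
    obtain ⟨P, hP⟩ := hY
    replace hP : ∀ p ∈ P.walk.support, ∀ i, ∀ z ∈ X i, ¬ Near G (200 * d) p z :=
      fun p hp i z hz => hP p hp z (Finset.mem_biUnion.2 ⟨i, Finset.mem_univ _, hz⟩)
    choose R hR using hT
    by_cases hnear : ∃ p ∈ P.walk.support, ∃ i, ∃ y ∈ T i, Near G (100 * d) p y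
    swap
    · push Not at hnear
      refine Or.inl (exists_family_cons P R (fun i p hp y hy hpy => ?_) fun i j hij =>
        (hfar i j hij).mono (by omega) (hR i) (hR j))
      exact hnear p hp i y (hR i hy) (hpy.mono (by omega))
    obtain ⟨i, x, W, hx, hWT, hWP⟩ := exists_approach T P.walk hnear
    -- `W` stays within `100 * d` of `P`, and `P` avoids the balls of radius `200 * d`.
    have hWX : ∀ p ∈ W.support, ∀ z ∈ X i, ¬ Near G (100 * d) p z := by
      intro p hp z hz hpz
      obtain ⟨q, hq, hqp⟩ := hWP p hp
      exact hP q hq i z hz ((hqp.trans hpz).mono (by omega))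
    have hWfar : ∀ n c j, i ≠ j → FarSets G c (T i) (T j) → n ≤ 100 * d → 2 * n ≤ c →
        FarSets G n (walkSet W) (T j) := fun n c j hij hc hn hnc =>
      (hWT j).farSets (hc.mono le_rfl (Set.singleton_subset_iff.2 hx) subset_rfl) hn hnc
    by_cases hi : i ∈ U
    · left
      obtain ⟨P₁, P₂, h₁, h₂, h₁₂⟩ := hsplit i hi P.fst P.fst_mem x hx W (hWT i)
        (fun z hz => hWX _ W.start_mem_support z hz) (fun z hz => hWX _ W.end_mem_support z hz)
      have hup : ∀ j, (Function.update R i P₂ j).verts ⊆ T j := by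
        intro j
        by_cases hj : j = i
        · subst hj
          simpa using h₂
        · simpa [hj] using hR j
      refine exists_family_cons P₁ (Function.update R i P₂) (fun j => ?_) fun j l hjl =>
        (hfar j l hjl).mono (by omega) (hup j) (hup l)
      by_cases hj : j = i
      · subst hj
        simpa using h₁₂
      · have hij : i ≠ j := fun h => hj h.symm
        exact ((hWfar d _ j hij (hfar i j hij) (by omega) (by omega)).union_left
          ((hfar i j hij).mono (by omega) subset_rfl subset_rfl)).mono le_rfl h₁ (hup j)
    · obtain ⟨E, hE, hE₁, hE₂⟩ := hpath i hi
      have hne : ∀ z ∈ X i, P.fst ≠ z := by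
        intro z hz h
        exact hP _ P.walk.start_mem_support i z hz (h ▸ Near.refl _ _)
      obtain ⟨h, hh, htri⟩ := exists_tripod (ε := 4 * d) (by omega) E.walk W
        (by rw [hE] at hx; exact hx)
        (fun p hp hn => hWX p hp _ hE₁ (hn.symm.mono (by omega)))
      obtain ⟨T', hT'split, hT'path, hT'near⟩ := exists_splits_of_hasTripod (A := A) (s := 100 * d)
        (ρ := 100 * d) hd (by omega) (by omega) (Or.inl hh) E.fst_mem P.fst_mem E.snd_mem
        (hne _ hE₁).symm E.fst_ne_snd (hne _ hE₂) htri
      have hT'far : ∀ n c j, i ≠ j → FarSets G c (T i) (T j) → 13 * d + n ≤ 100 * d →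
          2 * (13 * d + n) ≤ c → FarSets G n T' (T j) := by
        intro n c j hij hc hn hnc
        refine FarSets.of_near (S := walkSet E.walk ∪ walkSet W) ?_ hT'near le_rfl
        refine FarSets.union_left ?_ (hWfar _ c j hij hc hn hnc)
        exact hc.mono (by omega) (by rw [hE]; exact subset_rfl) subset_rfl
      -- The new set is within `13 * d` of `E` and `W`, and `W` keeps half of the old distance. The
      -- margins suffice: `2 * (13 + 25) ≤ 80` and `2 * (13 + 80) ≤ 200`.
      have h25 : ∀ j, i ≠ j → FarSets G (25 * d) T' (T j) := fun j hij =>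
        hT'far _ _ j hij (hfar₁ i j hij hi) (by omega) (by omega)
      have h80 : ∀ j, i ≠ j → j ∉ U → FarSets G (80 * d) T' (T j) := fun j hij hj =>
        hT'far _ _ j hij (hfar₂ i j hij hi hj) (by omega) (by omega)
      refine ih (insert i U) (Function.update T i T')
        (Function.update X i {E.fst, P.fst, E.snd, h}) ?_ ?_ ?_ ?_ ?_ ?_ ?_ ?_
      · rw [Finset.card_insert_of_notMem hi]
        omega
      · intro j
        by_cases hj : j = i
        · subst hj
          simpa using Finset.card_le_four
        · simpa [hj] using hX j
      · intro j
        by_cases hj : j = i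
        · subst hj
          simpa using hT'path
        · simpa [hj] using ⟨R j, hR j⟩
      · intro j hjU
        by_cases hj : j = i
        · subst hj
          simpa using hT'split
        · simpa [hj] using hsplit j (Finset.mem_of_mem_insert_of_ne hjU hj)
      · intro j hjU
        rw [Finset.mem_insert, not_or] at hjU
        simpa [hjU.1] using hpath j hjU.2
      · intro j l hjl
        by_cases hj : j = i
        · subst hj
          simpa [hjl.symm] using h25 l hjl
        · by_cases hl : l = i
          · subst hl
            simpa [hjl] using (h25 j hjl.symm).symm
          · simpa [hj, hl] using hfar j l hjl
      · intro j l hjl hjU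
        rw [Finset.mem_insert, not_or] at hjU
        by_cases hl : l = i
        · subst hl
          simpa [hjl] using (h80 j hjl.symm hjU.2).symm
        · simpa [hjU.1, hl] using hfar₁ j l hjl hjU.2
      · intro j l hjl hjU hlU
        rw [Finset.mem_insert, not_or] at hjU hlU
        simpa [hjU.1, hlU.1] using hfar₂ j l hjl hjU.2 hlU.2

/-! ### Translation to `setDist` and `ball`, and the induction on `k`. -/

theorem le_setDist {d : ℕ} {S T : Set V} (h : FarSets G d S T) : (d : ℕ∞) ≤ setDist G S T :=
  le_iInf₂ fun x hx => le_iInf₂ fun y hy => le_of_lt <| not_le.1 fun hc =>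
    h x hx y hy (near_of_edist_le hc)

theorem farSets_of_lt_setDist {c d : ℕ} {S T : Set V} (h : (d : ℕ∞) ≤ setDist G S T)
    (hcd : c < d) : FarSets G c S T := by
  intro x hx y hy hn
  have h₁ : setDist G S T ≤ c :=
    (iInf₂_le x hx).trans ((iInf₂_le y hy).trans (edist_le_of_near hn))
  have h₂ : (d : ℕ∞) ≤ (c : ℕ∞) := h.trans h₁
  exact absurd (Nat.cast_le.1 h₂) (by omega)

theorem mem_ball_of_near {X : Set V} {r : ℕ} {p z : V} (hz : z ∈ X) (h : Near G r p z) :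
    p ∈ ball G X r :=
  show setDist G X {p} ≤ r from (iInf₂_le z hz).trans
    ((iInf₂_le p (Set.mem_singleton p)).trans (edist_le_of_near h.symm))

/-- The theorem for `k + 1`, by induction on `k`. -/
theorem exists_family_or_balls_pow (k : ℕ) (G : SimpleGraph V) (A : Set V) :
    ∀ d : ℕ, 1 ≤ d →
    (∃ P : Fin (k + 1) → APath G A,
      ∀ i j, i ≠ j → (d : ℕ∞) ≤ setDist G (P i).verts (P j).verts) ∨
    (∃ X : Finset V, X.card ≤ 4 * k ∧ ∀ P : APath G A,
        (P.verts ∩ ball G (X : Set V) (256 ^ (k + 1) * d)).Nonempty) := by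
  classical
  induction k with
  | zero =>
    intro d _
    by_cases h : Nonempty (APath G A)
    · exact Or.inl ⟨fun _ => h.some, fun i j hij => absurd (Fin.ext (by omega)) hij⟩
    · exact Or.inr ⟨∅, by simp, fun P => absurd ⟨P⟩ h⟩
  | succ k ih =>
    intro d hd
    -- Any factor above `200` gives the initial separation. In the ball case, the factor passes from
    -- the distance into the power of `256` in the radius.
    rcases ih (256 * d) (by omega) with ⟨P, hP⟩ | ⟨X, hX, hXP⟩
    · have hP' : ∀ i j, i ≠ j → FarSets G (200 * d) (P i).verts (P j).verts :=
        fun i j hij => farSets_of_lt_setDist (hP i j hij) (by omega)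
      rcases exists_family_or_balls hd (k + 2) ∅ (fun i => (P i).verts)
        (fun i => {(P i).fst, (P i).snd}) (by simp) (fun i => Finset.card_le_two.trans (by norm_num))
        (fun i => ⟨P i, subset_rfl⟩) (by simp) (fun i _ => ⟨P i, rfl, by simp, by simp⟩)
        (fun i j hij => (hP' i j hij).mono (by omega) subset_rfl subset_rfl)
        (fun i j hij _ => (hP' i j hij).mono (by omega) subset_rfl subset_rfl)
        (fun i j hij _ _ => hP' i j hij) with ⟨Q, hQ⟩ | ⟨Y, hY, hYP⟩
      · exact Or.inl ⟨Q, fun i j hij => le_setDist (hQ i j hij)⟩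
      · refine Or.inr ⟨Y, hY, fun Q => ?_⟩
        obtain ⟨p, hp, z, hz, hpz⟩ := hYP Q
        refine ⟨p, hp, mem_ball_of_near hz (hpz.mono (Nat.mul_le_mul_right d ?_))⟩
        calc 200 ≤ 256 ^ 1 := by norm_num
          _ ≤ 256 ^ (k + 1 + 1) := Nat.pow_le_pow_right (by norm_num) (by omega)
    · refine Or.inr ⟨X, by omega, fun Q => ?_⟩
      rw [show 256 ^ (k + 1 + 1) * d = 256 ^ (k + 1) * (256 * d) by ring]
      exact hXP Q

end CoarseGallai

theorem theorem1 (k d : ℕ) (hk : 1 ≤ k) (hd : 1 ≤ d) {V : Type*} [Finite V]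
    (G : SimpleGraph V) (A : Set V) :
    (∃ P : Fin k → CoarseGallai.APath G A,
      ∀ i j, i ≠ j → (d : ℕ∞) ≤ CoarseGallai.setDist G (P i).verts (P j).verts) ∨
    (∃ X : Finset V, X.card ≤ 4 * k - 4 ∧
      ∀ P : CoarseGallai.APath G A,
        (P.verts ∩ CoarseGallai.ball G (X : Set V) (256 ^ k * d)).Nonempty) := by
  obtain ⟨k, rfl⟩ := Nat.exists_eq_add_of_le' hk
  rw [show 4 * (k + 1) - 4 = 4 * k by omega]
  exact CoarseGallai.exists_family_or_balls_pow k G A d hd
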